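/- Let $q$ be a prime power, let $1\le n\le m$, and fix a basis $\boldsymbol\alpha=(\alpha_1,\dots,\alpha_m)$ of $\mathbb F_{q^m}$ over $\mathbb F_q$. Write $[j]=q^j$; for a negative integer $j$, $x^{[j]}$ denotes the $j$-th power of the Frobenius automorphism $x\mapsto x^q$ of $\mathbb F_{q^m}$. For $\mathbf c=(c_1,\dots,c_N)\in\mathbb F_{q^m}^N$ write $\mathbf c=\sum_{i=1}^m\alpha_i\mathbf c_i$ with $\mathbf c_i\in\mathbb F_q^N$, and let $M(\mathbf c)\in\mathbb F_q^{m\times N}$ be the matrix with rows $\mathbf c_1,\dots,\mathbf c_m$. For an $\mathbb F_{q^m}$-linear code $\mathcal D\subseteq\mathbb F_{q^m}^N$, let $d_R(\mathcal D)$ be the minimum of $\operatorname{rk}M(\mathbf c-\mathbf d)$ over distinct $\mathbf c,\mathbf d\in\mathcal D$ (with $d_R(\mathcal D)=\infty$ if $\mathcal D=0$), and let $\mathcal D^\perp$ be the dual of $\mathcal D$ for $\mathbf c\cdot\mathbf d=\sum_j c_jd_j$. For $\mathbf b\in\mathbb F_{q^m}^m$ and $\mathbf a\in\mathbb F_{q^m}^n$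 put $\mathbf b\star\mathbf a=\sum_{i=1}^m b_i\mathbf a_i$, and for linear codes let $\mathcal B\star\mathcal A$ be the $\mathbb F_{q^m}$-span of all $\mathbf b\star\mathbf a$ with $\mathbf b\in\mathcal B$, $\mathbf a\in\mathcal A$. For $\mathbb F_{q^m}$-linear codes $\mathcal A,\mathcal C\subseteq\mathbb F_{q^m}^n$ and $\mathcal B\subseteq\mathbb F_{q^m}^m$, the pair $(\mathcal A,\mathcal B)$ is a $t$-rank error-correcting pair ($t$-RECP) of type I for $\mathcal C$ if (1) $\mathcal B\star\mathcal A\subseteq\mathcal C^\perp$; (2) $\dim_{\mathbb F_{q^m}}\mathcal A>t$; (3) $d_R(\mathcal B^\perp)>t$; (4) $d_R(\mathcal A)+d_R(\mathcal C)>n$. Let $\varphi_n:\mathbb F_{q^m}^n\to\mathbb F_{q^m}^m$ be the $\mathbb F_{q^m}$-linear map $\varphi_n(\mathbf c)=(F_{\mathbf c}(\alpha_1),\dots,F_{\mathbf c}(\alpha_m))$, where $F_{\mathbf c}$ is the unique $q$-linearized polynomial over $\mathbb F_{q^m}$ of degree less than $q^n$ with $F_{\mathbf c}(\alpha_i)=c_i$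 for $1\le i\le n$. For an $\mathbb F_{q^m}$-linear code $\mathcal B'\subseteq\mathbb F_{q^m}^n$, the pair $(\mathcal A,\mathcal B')$ is called a $t$-RECP of type I for $\mathcal C$ if $(\mathcal A,\varphi_n(\mathcal B'))$ is one. For an integer $r$ coprime to $m$, a vector $\mathbf b=(b_1,\dots,b_N)\in\mathbb F_{q^m}^N$ ($N\le m$) whose entries are linearly independent over $\mathbb F_q$, and $1\le k\le N$, the (generalized) Gabidulin code is $$\mathrm{Gab}_{k,m,N}(r,\mathbf b)=\{(F(b_1),\dots,F(b_N)) : F=a_0x+a_1x^{[r]}+\cdots+a_{k-1}x^{[(k-1)r]},\ a_0,\dots,a_{k-1}\in\mathbb F_{q^m}\}.$$ **Theorem.** Let $r$ be an integer coprime to $m$, let $\mathbf b\in\mathbb F_{q^m}^n$ have entries that are linearly independent over $\mathbb F_q$, and let $t>0$ with $2t\le n$. Put $\mathcal A=\mathrm{Gab}_{t+1,m,n}(r,\mathbf b)$, $\mathcal B=\mathrm{Gab}_{t,m,m}(r,\boldsymbol\alpha)$ and $\mathcal C=\mathrm{Gab}_{2t,m,n}(r,\mathbf b)^\perp$. Then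 $(\mathcal A,\mathcal B)$ is a $t$-RECP of type I for $\mathcal C$. If $r=1$, then also $(\mathcal A,\mathcal B')$ with $\mathcal B'=\mathrm{Gab}_{t,m,n}(1,\boldsymbol\alpha_n)$, $\boldsymbol\alpha_n=(\alpha_1,\dots,\alpha_n)$, is a $t$-RECP of type I for $\mathcal C$. -/

import Mathlib

open Polynomial

namespace RankCode

noncomputable section

section Defs

variable {K L : Type*} [Field K] [Fintype K] [Field L] [Algebra K L] {m n : ℕ}

/-- The matrix representation `M(c)` of `c ∈ L ^ n` in the basis `α` of `L` over `K`: the `j`-th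
column holds the coordinates of `c j`. -/
def matrixRep (α : Module.Basis (Fin m) K L) (c : Fin n → L) : Matrix (Fin m) (Fin n) K :=
  Matrix.of fun i j => α.repr (c j) i

/-- The rank weight of a vector. -/
def rankWeight (α : Module.Basis (Fin m) K L) (c : Fin n → L) : ℕ :=
  (matrixRep α c).rank

/-- The minimum rank distance of a code: the infimum of the rank distances between distinct
codewords. It is `⊤` for a code with at most one codeword. -/
def minRankDist (α : Module.Basis (Fin m) K L) (C : Submodule L (Fin n → L)) : ℕ∞ :=
  ⨅ (c ∈ C) (d ∈ C) (_ : c ≠ d), (rankWeight α (c - d) : ℕ∞)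

/-- The dual code for the extension inner product `c ⬝ d = c₁ d₁ + ⋯ + cₙ dₙ ∈ L`. -/
def dualCode (C : Submodule L (Fin n → L)) : Submodule L (Fin n → L) where
  carrier := {d | ∀ c ∈ C, c ⬝ᵥ d = 0}
  add_mem' := by
    intro a b ha hb c hc
    rw [dotProduct_add, ha c hc, hb c hc, add_zero]
  zero_mem' := by
    intro c _
    exact dotProduct_zero c
  smul_mem' := by
    intro s a ha c hc
    rw [dotProduct_smul, ha c hc, smul_zero]

/-- The product `b ⋆ a = ∑ i, b_i • a_i` of `b ∈ L ^ m` and `a ∈ L ^ n`, where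
`a = ∑ i, α_i • a_i` with rows `a_i ∈ K ^ n` (the rows of `M(a)`). -/
def starProd (α : Module.Basis (Fin m) K L) (b : Fin m → L) (a : Fin n → L) : Fin n → L :=
  fun j => ∑ i, b i * algebraMap K L (matrixRep α a i j)

/-- The `L`-linear span of all products `b ⋆ a` with `b ∈ B` and `a ∈ A`. -/
def starSpan (α : Module.Basis (Fin m) K L) (B : Submodule L (Fin m → L))
    (A : Submodule L (Fin n → L)) : Submodule L (Fin n → L) :=
  Submodule.span L {x | ∃ b ∈ B, ∃ a ∈ A, x = starProd α b a}

/-- `(A, B)` is a `t`-rank error-correcting pair of type I for `C`, where `A, C ⊆ L ^ n` and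
`B ⊆ L ^ m`. -/
structure IsRECPTypeI (α : Module.Basis (Fin m) K L) (t : ℕ) (A : Submodule L (Fin n → L))
    (B : Submodule L (Fin m → L)) (C : Submodule L (Fin n → L)) : Prop where
  star_le : starSpan α B A ≤ dualCode C
  lt_dim : t < Module.finrank L A
  lt_dist_dual : (t : ℕ∞) < minRankDist α (dualCode B)
  lt_dist_add : (n : ℕ∞) < minRankDist α A + minRankDist α C

/-- `(A, B')` is a `t`-rank error-correcting pair of type I for the `L`-linear map `φ` and `C`,
where all of `A, B', C` lie in `L ^ n`. -/
def IsRECPTypeIFor (α : Module.Basis (Fin m) K L) (φ : (Fin n → L) →ₗ[L] (Fin m → L)) (t : ℕ)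
    (A B' C : Submodule L (Fin n → L)) : Prop :=
  IsRECPTypeI α t A (B'.map φ) C

variable (K L) in
/-- The exponent `[j] = q ^ j`, where `q = #K`. For a negative integer `j`, where `q ^ j` is not a
natural number, `j` is first reduced modulo `m = [L : K]`; as `x ^ (q ^ m) = x` on `L`, the map
`x ↦ x ^ [j]` is then the `j`-th power of the Frobenius automorphism of `L` over `K`. -/
def frobExp (j : ℤ) : ℕ :=
  Fintype.card K ^ (if 0 ≤ j then j else j % (Module.finrank K L : ℤ)).toNat

variable (K L) in
/-- The `L`-linear space of `q`-linearized polynomials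
`a₀ x + a₁ x ^ [r] + a₂ x ^ [2 r] + ⋯ + a_{k-1} x ^ [(k-1) r]`. -/
def linPoly (r : ℤ) (k : ℕ) : Submodule L L[X] where
  carrier := {F | ∃ a : Fin k → L, F = ∑ i, C (a i) * X ^ frobExp K L ((i : ℕ) * r)}
  add_mem' := by
    rintro _ _ ⟨a, rfl⟩ ⟨b, rfl⟩
    refine ⟨a + b, ?_⟩
    simp [add_mul, Finset.sum_add_distrib]
  zero_mem' := ⟨0, by simp⟩
  smul_mem' := by
    rintro s _ ⟨a, rfl⟩
    refine ⟨s • a, ?_⟩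
    simp [Polynomial.smul_eq_C_mul, Finset.mul_sum, mul_assoc]

/-- The evaluation map `F ↦ (F(b₁), …, F(bₙ))`. -/
def evalAt (b : Fin n → L) : L[X] →ₗ[L] (Fin n → L) :=
  LinearMap.pi fun j => Polynomial.leval (b j)

variable (K) in
/-- The (generalized) Gabidulin code
`Gab_{k,m,n}(r, b) = {(F(b₁), …, F(bₙ)) | F ∈ linPoly r k}`. -/
def Gab (k : ℕ) (r : ℤ) (b : Fin n → L) : Submodule L (Fin n → L) :=
  (linPoly K L r k).map (evalAt b)

/-- The vector `α_n = (α₁, …, αₙ)` of the first `n ≤ m` elements of the basis `α`. -/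
def basisVec (α : Module.Basis (Fin m) K L) (h : n ≤ m) : Fin n → L :=
  fun i => α (Fin.castLE h i)

lemma frobExp_natCast (i : ℕ) : frobExp K L ((i : ℤ) * 1) = Fintype.card K ^ i := by
  simp [frobExp]

lemma pow_card_sum {ι : Type*} (s : Finset ι) (l : ι → K) (x : ι → L) (i : ℕ) :
    (∑ j ∈ s, l j • x j) ^ Fintype.card K ^ i
      = ∑ j ∈ s, l j • x j ^ Fintype.card K ^ i := by
  have h : ∀ y : L, ((FiniteField.frobeniusAlgHom K L) ^ i) y = y ^ Fintype.card K ^ i := by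
    intro y
    rw [AlgHom.coe_pow, FiniteField.coe_frobeniusAlgHom, pow_iterate]
  rw [← h, map_sum]
  refine Finset.sum_congr rfl fun j _ => ?_
  rw [← h, AlgHom.map_smul_of_tower]

/-- A linearized polynomial with at most `n` terms `a₀ x, …, a_{n-1} x ^ [n-1]` that vanishes at `n` linearly
independent points is zero. -/
lemma eq_zero_of_evalAt (b : Fin n → L) (hb : LinearIndependent K b) (a : Fin n → L)
    (h : evalAt b (∑ i, C (a i) * X ^ Fintype.card K ^ (i : ℕ)) = 0) : a = 0 := by
  set P : L[X] := ∑ i, C (a i) * X ^ Fintype.card K ^ (i : ℕ) with hP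
  have hq : 1 < Fintype.card K := Fintype.one_lt_card
  have h0 : ∀ j, P.eval (b j) = 0 := fun j => congrFun h j
  have hev : ∀ x, P.eval x = ∑ i, a i * x ^ Fintype.card K ^ (i : ℕ) := by
    intro x
    simp [hP, eval_finsetSum]
  have hPz : P = 0 := by
    refine Polynomial.eq_zero_of_natDegree_lt_card_of_eval_eq_zero P
      (f := fun l : Fin n → K => ∑ j, l j • b j) ?_ ?_ ?_
    · exact hb.fintypeLinearCombination_injective
    · intro l
      rw [hev]
      simp only [pow_card_sum, Finset.mul_sum]
      rw [Finset.sum_comm]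
      refine Finset.sum_eq_zero fun j _ => ?_
      have := h0 j
      rw [hev] at this
      simp only [mul_smul_comm, ← Finset.smul_sum, this, smul_zero]
    · rw [Fintype.card_fun, Fintype.card_fin]
      refine lt_of_le_of_lt (b := Fintype.card K ^ n - 1) ?_
        (Nat.sub_lt (by positivity) one_pos)
      refine Polynomial.natDegree_sum_le_of_forall_le _ _ fun i _ => ?_
      refine (natDegree_C_mul_X_pow_le _ _).trans ?_
      exact Nat.le_sub_one_of_lt (Nat.pow_lt_pow_right hq i.2)
  funext i
  have hc : P.coeff (Fintype.card K ^ (i : ℕ)) = a i := by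
    rw [hP, finsetSum_coeff, Finset.sum_eq_single i]
    · simp
    · intro j _ hj
      rw [coeff_C_mul_X_pow, if_neg]
      intro he
      exact hj (Fin.ext (Nat.pow_right_injective hq he).symm)
    · simp
  rw [← hc, hPz, coeff_zero]
  rfl

/-- Interpolation: for `n ≤ m` and `c ∈ L ^ n` there is a unique `q`-linearized polynomial `F` of
degree less than `q ^ n` with `F(α_i) = c_i` for `i = 1, …, n`. -/
theorem existsUnique_interp (α : Module.Basis (Fin m) K L) (h : n ≤ m) (c : Fin n → L) :
    ∃! F : L[X], F ∈ linPoly K L 1 n ∧ ∀ i : Fin n, F.eval (basisVec α h i) = c i := by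
  have hb : LinearIndependent K (basisVec α h) :=
    α.linearIndependent.comp _ (Fin.castLE_injective h)
  let T : (Fin n → L) →ₗ[L] (Fin n → L) :=
    evalAt (basisVec α h) ∘ₗ
      ∑ i : Fin n, (Polynomial.monomial (Fintype.card K ^ (i : ℕ))) ∘ₗ LinearMap.proj i
  have hT : ∀ a, T a =
      evalAt (basisVec α h) (∑ i, C (a i) * X ^ Fintype.card K ^ (i : ℕ)) := by
    intro a
    simp [T, C_mul_X_pow_eq_monomial]
  have hinj : Function.Injective T := by
    rw [injective_iff_map_eq_zero]
    intro a ha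
    exact eq_zero_of_evalAt _ hb a (by rw [← hT, ha])
  obtain ⟨a, ha⟩ := (LinearMap.injective_iff_surjective.mp hinj) c
  refine ⟨∑ i, C (a i) * X ^ Fintype.card K ^ (i : ℕ), ⟨⟨a, ?_⟩, ?_⟩, ?_⟩
  · simp only [frobExp_natCast]
  · intro i
    rw [← ha, hT]
    rfl
  · rintro G ⟨⟨a', rfl⟩, hG⟩
    simp only [frobExp_natCast] at hG ⊢
    have : a' = a := by
      apply hinj
      rw [ha, hT]
      funext i
      exact hG i
    rw [this]

/-- The interpolation polynomial `F_c`. -/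
def interpPoly (α : Module.Basis (Fin m) K L) (h : n ≤ m) (c : Fin n → L) : L[X] :=
  (existsUnique_interp α h c).choose

lemma interpPoly_mem (α : Module.Basis (Fin m) K L) (h : n ≤ m) (c : Fin n → L) :
    interpPoly α h c ∈ linPoly K L 1 n :=
  (existsUnique_interp α h c).choose_spec.1.1

lemma interpPoly_eval (α : Module.Basis (Fin m) K L) (h : n ≤ m) (c : Fin n → L) (i : Fin n) :
    (interpPoly α h c).eval (basisVec α h i) = c i :=
  (existsUnique_interp α h c).choose_spec.1.2 i

lemma interpPoly_unique (α : Module.Basis (Fin m) K L) (h : n ≤ m) (c : Fin n → L) (F : L[X])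
    (hF : F ∈ linPoly K L 1 n) (hc : ∀ i, F.eval (basisVec α h i) = c i) :
    F = interpPoly α h c :=
  (existsUnique_interp α h c).choose_spec.2 F ⟨hF, hc⟩

/-- The `L`-linear map `φ_n : L ^ n → L ^ m`, for `n ≤ m`, with `φ_n(c)_i = F_c(α_i)` for
`i = 1, …, m`. -/
def phi (α : Module.Basis (Fin m) K L) (h : n ≤ m) : (Fin n → L) →ₗ[L] (Fin m → L) where
  toFun c := fun i => (interpPoly α h c).eval (α i)
  map_add' c d := by
    funext i
    rw [← interpPoly_unique α h (c + d) (interpPoly α h c + interpPoly α h d)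
      (add_mem (interpPoly_mem α h c) (interpPoly_mem α h d))
      (fun j => by simp [interpPoly_eval])]
    simp
  map_smul' s c := by
    funext i
    rw [← interpPoly_unique α h (s • c) (s • interpPoly α h c)
      (Submodule.smul_mem _ s (interpPoly_mem α h c))
      (fun j => by simp [interpPoly_eval])]
    simp

end Defs

end

end RankCode

/-! Put σ = Frobenius^r. Coprimality of r and m makes K the fixed field of σ, and a Gabidulin
codeword is the tuple of values at b of a K-linear map G = ∑ aᵢ σ^i. Since G is K-linear, ⋆ becomes
composition (`starProd_map`): maps with t and t + 1 coefficients compose to one with 2t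
coefficients, which gives condition (1) through C^⊥ = Gab_{2t}^⊥⊥ ⊇ Gab_{2t}.

The other conditions rest on invertibility of the Moore matrix (σ^i(γ_l)) for independent γ. A
nonzero G with k coefficients has kernel of dimension less than k, so d(A) ≥ n - t and dim A = t +
1; dually, the dual of Gab_k has distance at least k + 1.

For r = 1, φ_n carries B' onto B (`map_phi_Gab`), so the second claim reduces to the first. -/

namespace RankCode

/-! ### Moore matrices of an automorphism -/

section Moore

variable {K L : Type*} [Field K] [Field L] [Algebra K L]

/-- The columns of the Moore matrix `(σ ^ i (γ l))` of a linearly independent family are linearly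
independent, if `K` is the fixed field of `σ`. -/
lemma moore_columns_independent (σ : L ≃ₐ[K] L)
    (hσ : ∀ x, σ x = x → x ∈ Set.range (algebraMap K L)) {s : ℕ} (γ : Fin s → L)
    (hγ : LinearIndependent K γ) (c : Fin s → L)
    (h : ∀ i < s, ∑ l, c l * (σ ^ i) (γ l) = 0) : c = 0 := by
  induction s with
  | zero => exact Subsingleton.elim _ _
  | succ s ih =>
    have htail : LinearIndependent K (fun l : Fin s => γ l.succ) :=
      hγ.comp _ (Fin.succ_injective s)
    by_cases h0 : c 0 = 0
    · have := ih (fun l => γ l.succ) htail (fun l => c l.succ) fun i hi => by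
        have := h i (by omega)
        rwa [Fin.sum_univ_succ, h0, zero_mul, zero_add] at this
      funext l
      refine Fin.cases h0 (fun l => congrFun this l) l
    · exfalso
      set e : Fin (s + 1) → L := fun l => c l / c 0 with he
      have hE : ∀ i < s + 1, ∑ l, e l * (σ ^ i) (γ l) = 0 := fun i hi => by
        simp_rw [he, div_mul_eq_mul_div, ← Finset.sum_div, h i hi, zero_div]
      have he0 : e 0 = 1 := div_self h0
      -- With e 0 = 1, applying σ to relation i and subtracting relation i + 1 cancels the first
      -- term. By induction every e l is fixed by σ, hence lies in K, and relation 0 then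
      -- contradicts the independence of γ.
      have hfix := ih (fun l => σ (γ l.succ))
        (htail.map' σ.toLinearMap (LinearMap.ker_eq_bot.mpr σ.injective))
        (fun l => σ (e l.succ) - e l.succ) fun i hi => by
          have h1 := congrArg σ (hE i (by omega))
          have h2 := hE (i + 1) (by omega)
          simp only [map_sum, map_mul, map_zero, ← AlgEquiv.mul_apply, ← pow_succ'] at h1
          rw [Fin.sum_univ_succ, he0] at h1 h2
          rw [map_one] at h1
          simp only [sub_mul, Finset.sum_sub_distrib, ← AlgEquiv.mul_apply, ← pow_succ]
          linear_combination h1 - h2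
      have hK : ∀ l, ∃ k : K, algebraMap K L k = e l := by
        refine Fin.cases ⟨1, by rw [map_one, he0]⟩ fun l => ?_
        exact hσ _ (sub_eq_zero.mp (congrFun hfix l))
      choose k hk using hK
      have hz := hE 0 (by omega)
      simp only [pow_zero, AlgEquiv.one_apply, ← hk, ← Algebra.smul_def] at hz
      have := Fintype.linearIndependent_iff.mp hγ k hz 0
      rw [← hk, this, map_zero] at he0
      exact zero_ne_one he0

/-- The rows of the Moore matrix `(σ ^ i (γ l))` of a linearly independent family are linearly
independent, if `K` is the fixed field of `σ`. -/
lemma moore_rows_independent (σ : L ≃ₐ[K] L)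
    (hσ : ∀ x, σ x = x → x ∈ Set.range (algebraMap K L)) {s : ℕ} (γ : Fin s → L)
    (hγ : LinearIndependent K γ) (a : Fin s → L)
    (h : ∀ l, ∑ i : Fin s, a i * (σ ^ (i : ℕ)) (γ l) = 0) : a = 0 := by
  let M : Matrix (Fin s) (Fin s) L := Matrix.of fun i l => (σ ^ (i : ℕ)) (γ l)
  have hM : Function.Injective M.mulVec := by
    refine (injective_iff_map_eq_zero M.mulVecLin).mpr fun c hc => ?_
    refine moore_columns_independent σ hσ γ hγ c fun i hi => ?_
    have := congrFun hc ⟨i, hi⟩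
    simpa [M, Matrix.mulVec, dotProduct, mul_comm] using this
  have hM' := Matrix.vecMul_injective_iff_isUnit.mpr (Matrix.mulVec_injective_iff_isUnit.mp hM)
  refine hM' ?_
  simp only [Matrix.zero_vecMul]
  funext l
  simpa [M, Matrix.vecMul, dotProduct] using h l

/-- The `K`-linear map `x ↦ ∑ i, a i * σ ^ i (x)`. -/
def skewEval (σ : L ≃ₐ[K] L) {k : ℕ} (a : Fin k → L) : L →ₗ[K] L :=
  ∑ i, a i • (σ ^ (i : ℕ)).toLinearMap

lemma skewEval_apply (σ : L ≃ₐ[K] L) {k : ℕ} (a : Fin k → L) (x : L) :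
    skewEval σ a x = ∑ i, a i * (σ ^ (i : ℕ)) x := by
  simp [skewEval]

end Moore

/-! ### Rank weights of evaluation and orthogonal vectors -/

section RankDistance

variable {K L : Type*} [Field K] [Field L] [Algebra K L] {m n : ℕ}

/-- The coordinate isomorphism L ≅ K^m sends the entries of c to the columns of M(c). -/
lemma rankWeight_eq_finrank_span (α : Module.Basis (Fin m) K L) (c : Fin n → L) :
    rankWeight α c = Module.finrank K (Submodule.span K (Set.range c)) := by
  rw [rankWeight, Matrix.rank_eq_finrank_span_cols,
    ← LinearEquiv.finrank_map_eq α.equivFun (Submodule.span K (Set.range c)),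
    Submodule.map_span, ← Set.range_comp]
  rfl

lemma le_minRankDist (α : Module.Basis (Fin m) K L) (C : Submodule L (Fin n → L)) (k : ℕ)
    (h : ∀ c ∈ C, c ≠ 0 → k ≤ rankWeight α c) : (k : ℕ∞) ≤ minRankDist α C := by
  refine le_iInf fun c => le_iInf fun hc => le_iInf fun d => le_iInf fun hd => le_iInf fun hcd => ?_
  exact Nat.cast_le.mpr (h _ (sub_mem hc hd) (sub_ne_zero.mpr hcd))

/-- The values of a nonzero skew polynomial with `k` coefficients at `n` independent points span a
space of dimension more than `n - k`. -/
lemma lt_rankWeight_skewEval (α : Module.Basis (Fin m) K L) (σ : L ≃ₐ[K] L)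
    (hσ : ∀ x, σ x = x → x ∈ Set.range (algebraMap K L)) (b : Fin n → L)
    (hb : LinearIndependent K b) {k : ℕ} (a : Fin k → L) (ha : a ≠ 0) :
    n < rankWeight α (fun j => skewEval σ a (b j)) + k := by
  let B : (Fin n → K) →ₗ[K] L := Fintype.linearCombination K b
  let g : (Fin n → K) →ₗ[K] L := skewEval σ a ∘ₗ B
  have hg : g.range = Submodule.span K (Set.range fun j => skewEval σ a (b j)) := by
    rw [LinearMap.range_comp, Fintype.range_linearCombination, Submodule.map_span, ← Set.range_comp]
    rfl
  rw [rankWeight_eq_finrank_span, ← hg]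
  have hrn := g.finrank_range_add_finrank_ker
  rw [Module.finrank_fin_fun] at hrn
  -- By rank-nullity; k independent zeros would force a = 0 by independence of the Moore rows.
  suffices Module.finrank K g.ker < k by omega
  by_contra! hk
  obtain ⟨v, hv⟩ := exists_linearIndependent_of_le_finrank hk
  refine ha (moore_rows_independent σ hσ (fun l => B (v l)) ?_ a fun l => ?_)
  · have h1 := hv.map' g.ker.subtype (Submodule.ker_subtype _)
    exact h1.map' B (LinearMap.ker_eq_bot.mpr hb.fintypeLinearCombination_injective)
  · rw [← skewEval_apply]
    exact (v l).2

/-- A nonzero vector orthogonal to `(σ ^ i (b j))_j` for all `i < k`, where the `b j` are linearly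
independent, has rank weight more than `k`. -/
lemma lt_rankWeight_of_orthogonal (α : Module.Basis (Fin m) K L) (σ : L ≃ₐ[K] L)
    (hσ : ∀ x, σ x = x → x ∈ Set.range (algebraMap K L)) (b : Fin n → L)
    (hb : LinearIndependent K b) {k : ℕ} (d : Fin n → L) (hd : d ≠ 0)
    (h : ∀ i < k, ∑ j, (σ ^ i) (b j) * d j = 0) : k < rankWeight α d := by
  rw [rankWeight_eq_finrank_span]
  set S := Submodule.span K (Set.range d) with hS
  have : Module.Finite K S := Module.Finite.span_of_finite K (Set.finite_range d)
  by_contra! hk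
  let β := Module.finBasis K S
  let D : Fin n → S := fun j => ⟨d j, Submodule.subset_span ⟨j, rfl⟩⟩
  have hdβ : ∀ j, d j = ∑ l, β.repr (D j) l • (β l : L) := fun j => by
    refine (congrArg S.subtype (β.sum_repr (D j)).symm).trans ?_
    rw [map_sum]
    rfl
  have hβ : LinearIndependent K (fun l => (β l : L)) :=
    β.linearIndependent.map' S.subtype (Submodule.ker_subtype _)
  have hσ' : ∀ x, σ⁻¹ x = x → x ∈ Set.range (algebraMap K L) := fun x hx => hσ x <| by
    conv_lhs => rw [← hx]
    rw [← AlgEquiv.mul_apply, mul_inv_cancel, AlgEquiv.one_apply]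
  -- Expand d in the basis β of its span and apply σ^(-i) to the i-th orthogonality relation: the
  -- scalars in K stay fixed, and ∑ j, λ_{jl} b_j become the coefficients of a Moore relation for
  -- σ⁻¹ and β. As dim S ≤ k, there are enough relations to make them vanish.
  have hγ := moore_columns_independent σ⁻¹ hσ' (fun l => (β l : L)) hβ
    (fun l => ∑ j, β.repr (D j) l • b j) fun i hi => by
      have h1 := congrArg ((σ⁻¹) ^ i) (h i (hi.trans_le hk))
      simp only [map_sum, map_mul, map_zero, ← AlgEquiv.mul_apply, inv_pow, inv_mul_cancel,
        AlgEquiv.one_apply] at h1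
      rw [← h1]
      simp_rw [hdβ, map_sum, map_smul, Finset.mul_sum, Finset.sum_mul, inv_pow]
      rw [Finset.sum_comm]
      simp only [mul_smul_comm, smul_mul_assoc]
  refine hd (funext fun j => ?_)
  rw [hdβ]
  refine Finset.sum_eq_zero fun l _ => ?_
  rw [Fintype.linearIndependent_iff.mp hb _ (congrFun hγ l) j, zero_smul]

/-- If the entries of `b` are the values of a `K`-linear map `G` at the basis `α`, then
`b ⋆ a = G ∘ a`. -/
lemma starProd_map (α : Module.Basis (Fin m) K L) (G : L →ₗ[K] L) (a : Fin n → L) :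
    starProd α (fun i => G (α i)) a = fun j => G (a j) := by
  funext j
  conv_rhs => rw [← α.sum_repr (a j), map_sum]
  refine Finset.sum_congr rfl fun i _ => ?_
  rw [map_smul, Algebra.smul_def, mul_comm]
  rfl

end RankDistance

/-! ### Gabidulin codes and the error-correcting pair -/

section Gabidulin

variable {K L : Type*} [Field K] [Fintype K] [Field L] [Algebra K L] {m n : ℕ}

lemma pow_frobExp [Finite L] (j : ℤ) (x : L) :
    x ^ frobExp K L j = (FiniteField.frobeniusAlgEquivOfAlgebraic K L ^ j) x := by
  have hnat : ∀ i : ℕ, x ^ Fintype.card K ^ i =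
      (FiniteField.frobeniusAlgEquivOfAlgebraic K L ^ (i : ℤ)) x := fun i => by
    rw [zpow_natCast, AlgEquiv.coe_pow, FiniteField.coe_frobeniusAlgEquivOfAlgebraic_iterate]
  rw [frobExp, hnat]
  split_ifs with hj
  · rw [Int.toNat_of_nonneg hj]
  · have hpos : 0 < Module.finrank K L := Module.finrank_pos
    rw [Int.toNat_of_nonneg (Int.emod_nonneg _ (by omega)),
      ← FiniteField.orderOf_frobeniusAlgEquivOfAlgebraic K L, zpow_mod_orderOf]

/-- If `r` is coprime to `[L : K]`, the fixed field of the `r`-th power of Frobenius is `K`. -/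
lemma mem_range_of_frobenius_zpow_fixed [Finite L] (r : ℤ)
    (hr : IsCoprime r (Module.finrank K L : ℤ)) (x : L)
    (hx : (FiniteField.frobeniusAlgEquivOfAlgebraic K L ^ r) x = x) :
    x ∈ Set.range (algebraMap K L) := by
  obtain ⟨u, v, huv⟩ := hr
  set φ := FiniteField.frobeniusAlgEquivOfAlgebraic K L with hφ
  have hmem : φ ^ r ∈ MulAction.stabilizer Gal(L/K) x := hx
  -- From u r + v [L : K] = 1 and φ^[L : K] = 1. So x is fixed by φ, which generates the Galois
  -- group.
  have hφu : φ = (φ ^ r) ^ u := by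
    conv_lhs => rw [← zpow_one φ, ← huv, zpow_add, zpow_mul, mul_comm v, zpow_mul, zpow_natCast,
      ← FiniteField.orderOf_frobeniusAlgEquivOfAlgebraic K L, pow_orderOf_eq_one, one_zpow, mul_one]
    rw [← zpow_mul, ← zpow_mul, mul_comm]
  have hφx : φ ∈ MulAction.stabilizer Gal(L/K) x := by
    rw [hφu]
    exact zpow_mem hmem u
  refine IntermediateField.mem_bot.mp ((IsGalois.mem_bot_iff_fixed x).mpr fun f => ?_)
  obtain ⟨i, rfl⟩ := (FiniteField.bijective_frobeniusAlgEquivOfAlgebraic_pow K L).2 f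
  exact pow_mem hφx i

lemma mem_Gab_iff [Finite L] (k : ℕ) (r : ℤ) (b c : Fin n → L) :
    c ∈ Gab K k r b ↔ ∃ a : Fin k → L,
      c = fun j => skewEval (FiniteField.frobeniusAlgEquivOfAlgebraic K L ^ r) a (b j) := by
  have hev : ∀ a : Fin k → L,
      evalAt b (∑ i, C (a i) * X ^ frobExp K L ((i : ℕ) * r)) =
        fun j => skewEval (FiniteField.frobeniusAlgEquivOfAlgebraic K L ^ r) a (b j) := by
    intro a
    funext j
    simp only [evalAt, LinearMap.pi_apply, leval_apply, eval_finsetSum, eval_mul, eval_C, eval_pow,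
      eval_X, pow_frobExp, skewEval_apply]
    refine Finset.sum_congr rfl fun i _ => ?_
    rw [mul_comm (i : ℤ) r, zpow_mul, zpow_natCast]
  constructor
  · rintro ⟨_, ⟨a, rfl⟩, rfl⟩
    exact ⟨a, hev a⟩
  · rintro ⟨a, rfl⟩
    exact ⟨_, ⟨a, rfl⟩, hev a⟩

lemma monomial_mem_Gab [Finite L] {k : ℕ} (r : ℤ) (b : Fin n → L) (x : L) {i : ℕ} (hi : i < k) :
    (fun j => x * ((FiniteField.frobeniusAlgEquivOfAlgebraic K L ^ r) ^ i) (b j)) ∈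
      Gab K k r b := by
  refine (mem_Gab_iff k r b _).mpr ⟨Pi.single ⟨i, hi⟩ x, ?_⟩
  funext j
  rw [skewEval_apply, Finset.sum_eq_single ⟨i, hi⟩]
  · simp
  · intro l _ hl
    rw [Pi.single_eq_of_ne hl, zero_mul]
  · simp

lemma le_dualCode_dualCode (C : Submodule L (Fin n → L)) : C ≤ dualCode (dualCode C) :=
  fun c hc d hd => by rw [dotProduct_comm]; exact hd c hc

variable (α : Module.Basis (Fin m) K L)

lemma finrank_Gab [Finite L] (r : ℤ) (hr : IsCoprime r (Module.finrank K L : ℤ)) (b : Fin n → L)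
    (hb : LinearIndependent K b) {k : ℕ} (hk : k ≤ n) : Module.finrank L (Gab K k r b) = k := by
  set σ := FiniteField.frobeniusAlgEquivOfAlgebraic K L ^ r with hσ
  let f : (Fin k → L) →ₗ[L] (Fin n → L) :=
    { toFun := fun a j => skewEval σ a (b j)
      map_add' := fun a a' => by
        funext j
        simp [skewEval_apply, add_mul, Finset.sum_add_distrib]
      map_smul' := fun s a => by
        funext j
        simp [skewEval_apply, Finset.mul_sum, mul_assoc] }
  have hf : Function.Injective f := by
    refine (injective_iff_map_eq_zero f).mpr fun a ha => ?_
    refine moore_rows_independent σ (mem_range_of_frobenius_zpow_fixed r hr)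
      (fun l => b (Fin.castLE hk l)) (hb.comp _ (Fin.castLE_injective hk)) a fun l => ?_
    rw [← skewEval_apply]
    exact congrFun ha _
  have hrange : Gab K k r b = f.range := by
    ext c
    rw [mem_Gab_iff, LinearMap.mem_range]
    exact exists_congr fun a => eq_comm
  rw [hrange, LinearMap.finrank_range_of_inj hf, Module.finrank_fin_fun]

/-- For k > n the truncated subtraction makes the bound trivial, so no bound on k is needed. -/
lemma le_minRankDist_Gab [Finite L] (r : ℤ) (hr : IsCoprime r (Module.finrank K L : ℤ)) (b : Fin n → L)
    (hb : LinearIndependent K b) (k : ℕ) :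
    ((n + 1 - k : ℕ) : ℕ∞) ≤ minRankDist α (Gab K k r b) := by
  refine le_minRankDist α _ _ fun c hc hc0 => ?_
  obtain ⟨a, rfl⟩ := (mem_Gab_iff k r b c).mp hc
  have ha : a ≠ 0 := by
    rintro rfl
    exact hc0 (funext fun j => by simp [skewEval_apply])
  have := lt_rankWeight_skewEval α _ (mem_range_of_frobenius_zpow_fixed r hr) b hb a ha
  omega

lemma le_minRankDist_dualCode_Gab [Finite L] (r : ℤ) (hr : IsCoprime r (Module.finrank K L : ℤ)) (b : Fin n → L)
    (hb : LinearIndependent K b) (k : ℕ) :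
    ((k + 1 : ℕ) : ℕ∞) ≤ minRankDist α (dualCode (Gab K k r b)) := by
  refine le_minRankDist α _ _ fun d hd hd0 => ?_
  refine lt_rankWeight_of_orthogonal α _ (mem_range_of_frobenius_zpow_fixed r hr) b hb d hd0
    fun i hi => ?_
  simpa [dotProduct] using hd _ (monomial_mem_Gab r b 1 hi)

lemma starSpan_Gab_le [Finite L] (r : ℤ) (b : Fin n → L) (s t : ℕ) :
    starSpan α (Gab K s r α) (Gab K (t + 1) r b) ≤ Gab K (s + t) r b := by
  refine Submodule.span_le.mpr ?_
  rintro _ ⟨β, hβ, a, ha, rfl⟩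
  obtain ⟨g, rfl⟩ := (mem_Gab_iff s r _ β).mp hβ
  obtain ⟨f, rfl⟩ := (mem_Gab_iff (t + 1) r b a).mp ha
  rw [starProd_map]
  set σ := FiniteField.frobeniusAlgEquivOfAlgebraic K L ^ r with hσ
  -- Since σ^i(f_l σ^l(x)) = σ^i(f_l) σ^(i+l)(x), the exponents reach at most (s - 1) + t.
  have : (fun j => skewEval σ g (skewEval σ f (b j))) =
      ∑ i : Fin s, ∑ l : Fin (t + 1),
        fun j => (g i * (σ ^ (i : ℕ)) (f l)) * (σ ^ ((i : ℕ) + l)) (b j) := by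
    funext j
    simp only [skewEval_apply, map_sum, map_mul, Finset.sum_apply, pow_add,
      AlgEquiv.mul_apply, mul_assoc]
    exact Finset.sum_comm
  rw [this]
  exact sum_mem fun i _ => sum_mem fun l _ => monomial_mem_Gab r b _ (by omega)

lemma linPoly_mono (r : ℤ) {k l : ℕ} (hkl : k ≤ l) : linPoly K L r k ≤ linPoly K L r l := by
  rintro _ ⟨a, rfl⟩
  refine sum_mem fun i _ => ⟨Pi.single (Fin.castLE hkl i) (a i), ?_⟩
  rw [Finset.sum_eq_single (Fin.castLE hkl i)]
  · simp
  · intro j _ hj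
    rw [Pi.single_eq_of_ne hj, C_0, zero_mul]
  · simp

/-- The map `φ_n` takes a Gabidulin code with evaluation points `α₁, …, αₙ` to the Gabidulin code
with evaluation points `α₁, …, α_m`. -/
lemma map_phi_Gab (h : n ≤ m) {k : ℕ} (hk : k ≤ n) :
    (Gab K k 1 (basisVec α h)).map (phi α h) = Gab K k 1 α := by
  rw [Gab, Gab, ← Submodule.map_comp]
  refine SetLike.coe_injective (Set.image_congr fun F hF => ?_)
  funext i
  -- With at most k ≤ n terms, F is its own interpolation polynomial.
  exact congrArg (Polynomial.eval (α i))
    (interpPoly_unique α h _ F (linPoly_mono 1 hk hF) fun _ => rfl).symm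

theorem isRECPTypeI_Gab (b : Fin n → L) (hb : LinearIndependent K b)
    (r : ℤ) (hr : IsCoprime r (m : ℤ)) (t : ℕ) (ht : 0 < t) (htn : 2 * t ≤ n) :
    IsRECPTypeI α t (Gab K (t + 1) r b) (Gab K t r α) (dualCode (Gab K (2 * t) r b)) := by
  have : Module.Finite K L := Module.Finite.of_basis α
  have : Finite L := Module.finite_of_finite K
  rw [← Fintype.card_fin m, ← Module.finrank_eq_card_basis α] at hr
  refine ⟨?_, ?_, ?_, ?_⟩
  · refine le_trans ?_ (le_dualCode_dualCode _)
    rw [two_mul]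
    exact starSpan_Gab_le α r b t t
  -- t + 1 ≤ 2t ≤ n, because t > 0.
  · rw [finrank_Gab r hr b hb (by omega)]
    exact Nat.lt_succ_self t
  · exact lt_of_lt_of_le (Nat.cast_lt.mpr (Nat.lt_succ_self t))
      (le_minRankDist_dualCode_Gab α r hr α α.linearIndependent t)
  -- The two bounds add up to (n - t) + (2t + 1) = n + t + 1.
  · refine lt_of_lt_of_le ?_ (add_le_add (le_minRankDist_Gab α r hr b hb (t + 1))
      (le_minRankDist_dualCode_Gab α r hr b hb (2 * t)))
    rw [← Nat.cast_add]
    exact Nat.cast_lt.mpr (by omega)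

end Gabidulin

end RankCode

theorem mainTheorem7 {K L : Type*} [Field K] [Fintype K] [Field L] [Algebra K L] {m n : ℕ}
    (α : Module.Basis (Fin m) K L) (hnm : n ≤ m) (b : Fin n → L) (hb : LinearIndependent K b)
    (r : ℤ) (hr : IsCoprime r (m : ℤ)) (t : ℕ) (ht : 0 < t) (htn : 2 * t ≤ n) :
    RankCode.IsRECPTypeI α t
        (RankCode.Gab K (t + 1) r b)
        (RankCode.Gab K t r α)
        (RankCode.dualCode (RankCode.Gab K (2 * t) r b)) ∧
      (r = 1 →
        RankCode.IsRECPTypeIFor α (RankCode.phi α hnm) t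
          (RankCode.Gab K (t + 1) r b)
          (RankCode.Gab K t r (RankCode.basisVec α hnm))
          (RankCode.dualCode (RankCode.Gab K (2 * t) r b))) := by
  have h := RankCode.isRECPTypeI_Gab α b hb r hr t ht htn
  refine ⟨h, ?_⟩
  rintro rfl
  rw [RankCode.IsRECPTypeIFor, RankCode.map_phi_Gab α hnm (by omega)]
  exact h
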